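/- Let $(X,d)$ be a compact metric space with a Borel measure $\mu$, and let $1\le p<\infty$. Write $B(x,r)$ for open balls. Assume that * (doubling) there is $C>0$ with $0<\mu(B(x,2r))\le C\,\mu(B(x,r))<\infty$ for all $x\in X$, $r>0$; * ($(p,p)$-Poincaré inequality) there are $C>0$ and $\lambda\ge 1$ such that for every Lipschitz $f\colon X\to\mathbb R$ and every ball $B=B(x,R)$, $R>0$, $$\int_{B}|f-f_{B}|^p\,d\mu\le C R^p\int_{B(x,\lambda R)}(\mathrm{Lip} f)^p\,d\mu,$$ where $f_B=\frac1{\mu(B)}\int_B f\,d\mu$ and $(\mathrm{Lip} f)(y)=\limsup_{r\to0^+}\sup_{d(x,y)\le r}\frac{|f(x)-f(y)|}{r}$. For $f\in L^p(X,\mu)$ and $r>0$ let $$E_{p,r}(f)=\frac1{r^p}\int_X\frac1{\mu(B(x,r))}\int_{B(x,r)}|f(y)-f(x)|^p\,d\mu(y)\,d\mu(x),\qquad KS^{1,p}(X)=\Big\{f\in L^p(X,\mu):\limsup_{r\to0^+}E_{p,r}(f)<\infty\Big\}.$$ A sequence of functionals $E_n\colon L^p(X,\mu)\to[-\infty,\infty]$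 *Mosco-converges* to $E\colon L^p(X,\mu)\to[-\infty,\infty]$ if (i) $E(f)\le\liminf_n E_n(f_n)$ whenever $f_n\to f$ weakly in $L^p(X,\mu)$, and (ii) every $f\in L^p(X,\mu)$ is the strong limit in $L^p(X,\mu)$ of some sequence $(f_n)$ with $\limsup_n E_n(f_n)\le E(f)$. It *$\Gamma$-converges* to $E$ if (i) is required only for strongly convergent sequences, and (ii) holds. Then there is a sequence $r_n>0$ with $r_n\to0$ such that $(E_{p,r_n})_n$ $\Gamma$-converges in $L^p(X,\mu)$. Moreover, for every sequence $r_n>0$ with $r_n\to 0$ for which $(E_{p,r_n})_n$ has a $\Gamma$-limit $\mathcal E_p$ (the $p$-energy), one has $\{f\in L^p(X,\mu):\mathcal E_p(f)<\infty\}=KS^{1,p}(X)$, and $(E_{p,r_n})_n$ Mosco-converges to $\mathcal E_p$. -/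

import Mathlib

open Filter Topology MeasureTheory
open scoped NNReal ENNReal

noncomputable section

namespace KorevaarSchoen

/-- The measure `μ` is positive and finite on balls and doubling: for one constant `C`,
`0 < μ (B(x, 2r)) ≤ C μ (B(x, r)) < ∞` for all `x` and all `r > 0`. -/
def IsDoubling {X : Type*} [PseudoMetricSpace X] [MeasurableSpace X] (μ : Measure X) : Prop :=
  ∃ C : ℝ≥0, ∀ (x : X) (r : ℝ), 0 < r →
    0 < μ (Metric.ball x (2 * r)) ∧
    μ (Metric.ball x (2 * r)) ≤ C * μ (Metric.ball x r) ∧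
    μ (Metric.ball x r) < ∞

/-- The pointwise Lipschitz constant
`(Lip f)(y) = limsup_{r → 0+} sup_{d(x,y) ≤ r} |f x - f y| / r`, as an extended nonnegative
number. -/
def pointwiseLip {X : Type*} [PseudoMetricSpace X] (f : X → ℝ) (y : X) : ℝ≥0∞ :=
  limsup (fun r : ℝ => ⨆ x ∈ Metric.closedBall y r, ‖f x - f y‖ₑ / ENNReal.ofReal r) (𝓝[>] 0)

/-- The `(p,p)`-Poincaré inequality for Lipschitz functions (`1 ≤ p < ∞`):
`∫_{B(x,R)} |f - f_{B(x,R)}|^p dμ ≤ C R^p ∫_{B(x,λR)} (Lip f)^p dμ`,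
with `C` and `λ ≥ 1` independent of the Lipschitz function `f` and of the ball. -/
def PoincareLip {X : Type*} [PseudoMetricSpace X] [MeasurableSpace X] (p : ℝ≥0∞)
    (μ : Measure X) : Prop :=
  ∃ (C : ℝ≥0) (lam : ℝ), 1 ≤ lam ∧
    ∀ f : X → ℝ, (∃ K : ℝ≥0, LipschitzWith K f) → ∀ (x : X) (R : ℝ), 0 < R →
      ∫⁻ y in Metric.ball x R, ‖f y - ⨍ z in Metric.ball x R, f z ∂μ‖ₑ ^ p.toReal ∂μ
        ≤ C * ENNReal.ofReal R ^ p.toReal *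
          ∫⁻ y in Metric.ball x (lam * R), pointwiseLip f y ^ p.toReal ∂μ

/-- The Korevaar-Schoen type energy
`E_{p,r}(f) = r^{-p} ∫_X ⨍_{B(x,r)} |f y - f x|^p dμ(y) dμ(x)` of `f ∈ L^p(X, μ)`. -/
def energy {X : Type*} [PseudoMetricSpace X] [MeasurableSpace X] (p : ℝ≥0∞) (μ : Measure X)
    (r : ℝ) (f : Lp ℝ p μ) : ℝ≥0∞ :=
  (ENNReal.ofReal r ^ p.toReal)⁻¹ *
    ∫⁻ x, ⨍⁻ y in Metric.ball x r, ‖f y - f x‖ₑ ^ p.toReal ∂μ ∂μ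

/-- The Korevaar-Schoen space `KS^{1,p}(X)`: all `f ∈ L^p(X, μ)` with
`limsup_{r → 0+} E_{p,r}(f) < ∞`. -/
def space {X : Type*} [PseudoMetricSpace X] [MeasurableSpace X] (p : ℝ≥0∞) (μ : Measure X) :
    Set (Lp ℝ p μ) :=
  {f | limsup (fun r : ℝ => energy p μ r f) (𝓝[>] 0) < ∞}

/-- `Γ`-convergence of a sequence of functionals with respect to strong (norm) convergence. -/
def GammaConverges {V : Type*} [NormedAddCommGroup V] (E : ℕ → V → EReal) (F : V → EReal) :
    Prop :=
  (∀ (f : V) (u : ℕ → V), Tendsto u atTop (𝓝 f) →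
    F f ≤ liminf (fun n => E n (u n)) atTop) ∧
  (∀ f : V, ∃ u : ℕ → V, Tendsto u atTop (𝓝 f) ∧
    limsup (fun n => E n (u n)) atTop ≤ F f)

/-- Mosco convergence of a sequence of functionals: the lower bound holds along weakly convergent
sequences, and there are strongly convergent recovery sequences. -/
def MoscoConverges {V : Type*} [NormedAddCommGroup V] [NormedSpace ℝ V]
    (E : ℕ → V → EReal) (F : V → EReal) : Prop :=
  (∀ (f : V) (u : ℕ → V),
    Tendsto (fun n => toWeakSpace ℝ V (u n)) atTop (𝓝 (toWeakSpace ℝ V f)) →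
    F f ≤ liminf (fun n => E n (u n)) atTop) ∧
  (∀ f : V, ∃ u : ℕ → V, Tendsto u atTop (𝓝 f) ∧
    limsup (fun n => E n (u n)) atTop ≤ F f)

/-- `F` is the `p`-energy generated by the scales `r n`: the `r n` are positive and tend to zero,
and `F` is the `Γ`-limit in `L^p(X, μ)` of the energies `E_{p, r n}`. -/
structure IsPEnergy {X : Type*} [PseudoMetricSpace X] [MeasurableSpace X] (p : ℝ≥0∞)
    [Fact (1 ≤ p)] (μ : Measure X) (r : ℕ → ℝ) (F : Lp ℝ p μ → EReal) : Prop where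
  pos : ∀ n, 0 < r n
  tendsto_zero : Tendsto r atTop (𝓝 0)
  gammaConverges : GammaConverges (fun n f => (energy p μ (r n) f : EReal)) F

end KorevaarSchoen

end

/-! Everything rests on almost monotonicity of the energies: `E_{p,R}(f) ≤ C E_{p,r}(f)` whenever `r
≤ R` (`PoincareLip.exists_energyFun_le_energyFun`). To see it, replace `f` by a Lipschitz average
`g` at scale `r`. Both `|f - g|` and `r · Lip g` are bounded by the mean oscillation of `f` on balls
of radius `r`. Poincaré and doubling bound `E_{p,R}(g)` by `∫ (Lip g)^p`, hence by `E_{p,r}(f)`; the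
remainder costs `R^{-p} ‖f - g‖^p`, which is also at most a multiple of `E_{p,r}(f)` because `r ≤
R`.

A `Γ`-convergent sequence exists by general compactness, `L^p` being separable. If the limit is
finite at `f`, a recovery sequence has bounded energies at scales `r n`, hence at each fixed `R` by
almost monotonicity, and continuity of `E_{p,R}` up to constants bounds `E_{p,R}(f)` uniformly in
`R`. The converse uses the constant sequence.

For Mosco convergence, finite rank averaging at scale `R` moves `u` by at most `C R
E_{p,R}(u)^{1/p}`. Bounded energies at vanishing scales thus make weak convergence strong
(`PoincareLip.tendsto_of_forall_dual_tendsto`), and the two lower bounds coincide. Reflexivity plays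
no role, so `p = 1` is included. -/

namespace KorevaarSchoen

/-! ### Averages, doubling and Tonelli on balls. -/

section


section General

variable {α : Type*} [MeasurableSpace α] {ν : Measure α}

/-- Jensen's inequality for the average of a power. -/
theorem laverage_rpow_le [IsFiniteMeasure ν] {q : ℝ} (hq : 1 ≤ q) {f : α → ℝ≥0∞}
    (hf : AEMeasurable f ν) : (⨍⁻ x, f x ∂ν) ^ q ≤ ⨍⁻ x, f x ^ q ∂ν := by
  have hq0 : 0 < q := zero_lt_one.trans_le hq
  rcases eq_or_ne ν 0 with rfl | hν
  · simp [hq0]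
  have : NeZero ν := ⟨hν⟩
  -- The average integrates against a probability measure, for which `L^q` norms increase with `q`.
  have h := eLpNorm'_le_eLpNorm'_of_exponent_le (f := f) zero_lt_one hq
    ((ν Set.univ)⁻¹ • ν) (hf.smul_measure _).aestronglyMeasurable
  simp only [eLpNorm', enorm_eq_self, ENNReal.rpow_one, div_one] at h
  calc (⨍⁻ x, f x ∂ν) ^ q ≤ ((⨍⁻ x, f x ^ q ∂ν) ^ (1 / q)) ^ q :=
        ENNReal.rpow_le_rpow h hq0.le
    _ = ⨍⁻ x, f x ^ q ∂ν := by
        rw [← ENNReal.rpow_mul, one_div_mul_cancel hq0.ne', ENNReal.rpow_one]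

theorem inv_le_mul_inv_of_le_mul {a b D : ℝ≥0∞} (hb : b ≠ 0) (hb' : b ≠ ∞)
    (h : b ≤ D * a) : a⁻¹ ≤ D * b⁻¹ := by
  rw [← div_eq_mul_inv, ENNReal.le_div_iff_mul_le (Or.inl hb) (Or.inl hb'), mul_comm,
    ← div_eq_mul_inv]
  exact ENNReal.div_le_of_le_mul h

theorem setLAverage_le_mul_setLAverage {s t : Set α} (hst : s ⊆ t) {D : ℝ≥0∞}
    (hs : ν s ≠ 0) (ht' : ν t ≠ ∞) (hD : ν t ≤ D * ν s) (f : α → ℝ≥0∞) :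
    ⨍⁻ x in s, f x ∂ν ≤ D * ⨍⁻ x in t, f x ∂ν := by
  have ht : ν t ≠ 0 := fun h => hs (measure_mono_null hst h)
  rw [setLAverage_eq, setLAverage_eq, div_eq_mul_inv, div_eq_mul_inv]
  calc (∫⁻ x in s, f x ∂ν) * (ν s)⁻¹ ≤ (∫⁻ x in t, f x ∂ν) * (D * (ν t)⁻¹) :=
        mul_le_mul' (lintegral_mono_set hst) (inv_le_mul_inv_of_le_mul ht ht' hD)
    _ = _ := by ring

end General

variable {X : Type*} [PseudoMetricSpace X] [MeasurableSpace X] {μ : Measure X}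

theorem IsDoubling.measure_ball_pos (h : IsDoubling μ) (x : X) {r : ℝ} (hr : 0 < r) :
    0 < μ (Metric.ball x r) := by
  obtain ⟨C, hC⟩ := h
  simpa [mul_div_cancel₀] using (hC x (r / 2) (by positivity)).1

theorem IsDoubling.measure_ball_lt_top (h : IsDoubling μ) (x : X) (r : ℝ) :
    μ (Metric.ball x r) < ∞ := by
  obtain ⟨C, hC⟩ := h
  rcases lt_or_ge 0 r with hr | hr
  · exact (hC x r hr).2.2
  · simp [Metric.ball_eq_empty.2 hr]

theorem IsDoubling.isFiniteMeasure [CompactSpace X] (h : IsDoubling μ) : IsFiniteMeasure μ := by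
  rcases isEmpty_or_nonempty X with hX | ⟨⟨x⟩⟩
  · refine ⟨?_⟩
    rw [Set.eq_empty_of_isEmpty (Set.univ : Set X)]
    simp
  · obtain ⟨R, hR⟩ := (isCompact_univ (X := X)).isBounded.subset_ball x
    exact ⟨(measure_mono hR).trans_lt (h.measure_ball_lt_top x R)⟩

/-- Balls of comparable radii around points at comparable distance have comparable measures. -/
theorem IsDoubling.exists_measure_ball_le (h : IsDoubling μ) (L : ℝ) :
    ∃ D : ℝ≥0, ∀ (x y : X) (r s : ℝ), 0 < r → s + dist x y ≤ L * r →
      μ (Metric.ball x s) ≤ D * μ (Metric.ball y r) := by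
  obtain ⟨C, hC⟩ := h
  obtain ⟨n, hn⟩ := pow_unbounded_of_one_lt L (one_lt_two (α := ℝ))
  have key : ∀ (m : ℕ) (y : X) (r : ℝ), 0 < r →
      μ (Metric.ball y (2 ^ m * r)) ≤ (C : ℝ≥0∞) ^ m * μ (Metric.ball y r) := by
    intro m y r hr
    induction m with
    | zero => simp
    | succ m ih =>
      calc μ (Metric.ball y (2 ^ (m + 1) * r)) = μ (Metric.ball y (2 * (2 ^ m * r))) := by
            ring_nf
        _ ≤ C * μ (Metric.ball y (2 ^ m * r)) := (hC y _ (by positivity)).2.1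
        _ ≤ C * ((C : ℝ≥0∞) ^ m * μ (Metric.ball y r)) := by gcongr
        _ = _ := by ring
  refine ⟨C ^ n, fun x y r s hr hs => ?_⟩
  push_cast
  refine (measure_mono (Metric.ball_subset_ball' (hs.trans ?_))).trans (key n y r hr)
  gcongr

variable [OpensMeasurableSpace X] [SecondCountableTopology X]

theorem measurable_setLIntegral_ball [SFinite μ] (s : ℝ) {F : X → X → ℝ≥0∞}
    (hF : Measurable (Function.uncurry F)) :
    Measurable fun x => ∫⁻ y in Metric.ball x s, F x y ∂μ := by
  have : ∀ x, ∫⁻ y in Metric.ball x s, F x y ∂μ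
      = ∫⁻ y, {z : X × X | dist z.2 z.1 < s}.indicator (Function.uncurry F) (x, y) ∂μ := by
    intro x
    rw [← lintegral_indicator Metric.isOpen_ball.measurableSet]
    rfl
  simp_rw [this]
  refine Measurable.lintegral_prod_right' (f := {z : X × X | dist z.2 z.1 < s}.indicator _) ?_
  exact hF.indicator (measurableSet_lt (by fun_prop) measurable_const)

theorem measurable_measure_ball [SFinite μ] (s : ℝ) :
    Measurable fun x => μ (Metric.ball x s) := by
  simpa using measurable_setLIntegral_ball (μ := μ) s (F := fun _ _ => 1) measurable_const

theorem measurable_setLAverage_ball [SFinite μ] (s : ℝ) {F : X → X → ℝ≥0∞}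
    (hF : Measurable (Function.uncurry F)) :
    Measurable fun x => ⨍⁻ y in Metric.ball x s, F x y ∂μ := by
  simp_rw [setLAverage_eq]
  exact (measurable_setLIntegral_ball s hF).div (measurable_measure_ball s)

/-- Tonelli, since `y ∈ B(x, s)` is symmetric in `x` and `y`. -/
theorem lintegral_mul_setLIntegral_ball [SFinite μ] (s : ℝ) {a H : X → ℝ≥0∞}
    (ha : Measurable a) (hH : Measurable H) :
    ∫⁻ x, a x * ∫⁻ y in Metric.ball x s, H y ∂μ ∂μ
      = ∫⁻ y, H y * ∫⁻ x in Metric.ball y s, a x ∂μ ∂μ := by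
  have h1 : ∀ x, a x * ∫⁻ y in Metric.ball x s, H y ∂μ
      = ∫⁻ y, {z : X × X | dist z.2 z.1 < s}.indicator (fun z => a z.1 * H z.2) (x, y) ∂μ := by
    intro x
    rw [← lintegral_const_mul _ hH, ← lintegral_indicator Metric.isOpen_ball.measurableSet]
    rfl
  have h2 : ∀ y, H y * ∫⁻ x in Metric.ball y s, a x ∂μ
      = ∫⁻ x, {z : X × X | dist z.2 z.1 < s}.indicator (fun z => a z.1 * H z.2) (x, y) ∂μ := by
    intro y
    rw [← lintegral_const_mul _ ha, ← lintegral_indicator Metric.isOpen_ball.measurableSet]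
    refine lintegral_congr fun x => ?_
    simp only [Set.indicator, Metric.mem_ball, Set.mem_ofPred_eq, dist_comm x y, mul_comm]
  simp_rw [h1, h2]
  refine lintegral_lintegral_swap (Measurable.aemeasurable ?_)
  change Measurable ({z : X × X | dist z.2 z.1 < s}.indicator (fun z => a z.1 * H z.2))
  exact Measurable.indicator (by fun_prop) (measurableSet_lt (by fun_prop) measurable_const)

end

/-! ### Energies of Lipschitz functions under the Poincaré inequality. -/

section


variable {X : Type*} [PseudoMetricSpace X] [MeasurableSpace X] {μ : Measure X}

/-- The Korevaar-Schoen energy of a function at scale `r` with exponent `q`. -/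
noncomputable def energyFun (q : ℝ) (μ : Measure X) (r : ℝ) (f : X → ℝ) : ℝ≥0∞ :=
  (ENNReal.ofReal r ^ q)⁻¹ * ∫⁻ x, ⨍⁻ y in Metric.ball x r, ‖f y - f x‖ₑ ^ q ∂μ ∂μ

theorem mul_energyFun (q : ℝ) {r : ℝ} (hr : 0 < r) (hq : 0 ≤ q) (f : X → ℝ) :
    ENNReal.ofReal r ^ q * energyFun q μ r f
      = ∫⁻ x, ⨍⁻ y in Metric.ball x r, ‖f y - f x‖ₑ ^ q ∂μ ∂μ := by
  have h1 : ENNReal.ofReal r ^ q ≠ 0 := by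
    simp [ENNReal.rpow_eq_zero_iff, hr, hq.not_gt]
  have h2 : ENNReal.ofReal r ^ q ≠ ∞ := ENNReal.rpow_ne_top_of_nonneg hq ENNReal.ofReal_ne_top
  rw [energyFun, ← mul_assoc, ENNReal.mul_inv_cancel h1 h2, one_mul]

theorem enorm_sub_rpow_le {q : ℝ} (hq : 1 ≤ q) (a b c : ℝ) :
    ‖a - b‖ₑ ^ q ≤ 2 ^ (q - 1) * (‖a - c‖ₑ ^ q + ‖b - c‖ₑ ^ q) := by
  calc ‖a - b‖ₑ ^ q ≤ (‖a - c‖ₑ + ‖b - c‖ₑ) ^ q := by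
        refine ENNReal.rpow_le_rpow ?_ (zero_le_one.trans hq)
        calc ‖a - b‖ₑ = ‖(a - c) - (b - c)‖ₑ := by congr 1; ring
          _ ≤ _ := enorm_sub_le
    _ ≤ _ := ENNReal.rpow_add_le_mul_rpow_add_rpow _ _ hq

/-- For `x ∈ B(y, LR)` the ball `B(y, LR)` lies in `B(x, 2LR)`, so the integrand is at most `D /
μ(B(y, LR))`. -/
theorem IsDoubling.exists_setLIntegral_inv_measure_ball_le (h : IsDoubling μ) {L : ℝ}
    (hL : 0 < L) : ∃ D : ℝ≥0, ∀ R : ℝ, 0 < R → ∀ y,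
      ∫⁻ x in Metric.ball y (L * R), (μ (Metric.ball x R))⁻¹ ∂μ ≤ D := by
  obtain ⟨D, hD⟩ := h.exists_measure_ball_le (2 * L)
  refine ⟨D, fun R hR y => ?_⟩
  have hLR : 0 < L * R := by positivity
  have hp := (h.measure_ball_pos y hLR).ne'
  have hf := (h.measure_ball_lt_top y (L * R)).ne
  calc ∫⁻ x in Metric.ball y (L * R), (μ (Metric.ball x R))⁻¹ ∂μ
      ≤ ∫⁻ x in Metric.ball y (L * R), D * (μ (Metric.ball y (L * R)))⁻¹ ∂μ := by
        refine setLIntegral_mono measurable_const fun x hx => ?_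
        refine inv_le_mul_inv_of_le_mul hp hf (hD y x R _ hR ?_)
        have := Metric.mem_ball'.1 hx
        linarith
    _ = D := by
        rw [setLIntegral_const, mul_assoc, ENNReal.inv_mul_cancel hp hf, mul_one]

variable [OpensMeasurableSpace X] [SecondCountableTopology X]

/-- Integral inequalities on all balls of a fixed radius add up to a global inequality. -/
theorem IsDoubling.exists_lintegral_le_of_ball [SFinite μ] (h : IsDoubling μ) {L : ℝ}
    (hL : 0 < L) :
    ∃ D : ℝ≥0, ∀ R : ℝ, 0 < R → ∀ (K : ℝ≥0∞) (Φ H : X → ℝ≥0∞), Measurable Φ → Measurable H →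
      (∀ z, ∫⁻ x in Metric.ball z R, Φ x ∂μ ≤ K * ∫⁻ x in Metric.ball z (L * R), H x ∂μ) →
      ∫⁻ x, Φ x ∂μ ≤ D * K * ∫⁻ x, H x ∂μ := by
  obtain ⟨D₁, hD₁⟩ := h.exists_measure_ball_le 2
  obtain ⟨D₂, hD₂⟩ := h.exists_setLIntegral_inv_measure_ball_le hL
  refine ⟨D₁ * D₂, fun R hR K Φ H hΦ hH hle => ?_⟩
  -- Averaging the local inequalities over all centres `z` with weight `a` replaces a cover of
  -- bounded overlap: the integral of `a` over `B(y, R)` is bounded below, and over `B(y, LR)`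
  -- above, uniformly in `y`.
  set a : X → ℝ≥0∞ := fun z => (μ (Metric.ball z R))⁻¹ with ha
  have ham : Measurable a := (measurable_measure_ball R).inv
  have hp : ∀ x, ∀ s : ℝ, 0 < s → μ (Metric.ball x s) ≠ 0 := fun x s hs =>
    (h.measure_ball_pos x hs).ne'
  have hf : ∀ x, ∀ s : ℝ, μ (Metric.ball x s) ≠ ∞ := fun x s => (h.measure_ball_lt_top x s).ne
  have lower : ∀ y, 1 ≤ D₁ * ∫⁻ x in Metric.ball y R, a x ∂μ := by
    intro y
    calc 1 = ∫⁻ x in Metric.ball y R, (μ (Metric.ball y R))⁻¹ ∂μ := by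
          rw [setLIntegral_const, ENNReal.inv_mul_cancel (hp y R hR) (hf y R)]
      _ ≤ ∫⁻ x in Metric.ball y R, D₁ * a x ∂μ := by
          refine setLIntegral_mono (ham.const_mul _) fun x hx => ?_
          refine inv_le_mul_inv_of_le_mul (hp x R hR) (hf x R) (hD₁ x y R R hR ?_)
          have := Metric.mem_ball.1 hx
          linarith
      _ = _ := lintegral_const_mul _ ham
  calc ∫⁻ x, Φ x ∂μ ≤ ∫⁻ x, D₁ * (Φ x * ∫⁻ z in Metric.ball x R, a z ∂μ) ∂μ := by
        refine lintegral_mono fun x => ?_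
        calc Φ x = Φ x * 1 := (mul_one _).symm
          _ ≤ Φ x * (D₁ * ∫⁻ z in Metric.ball x R, a z ∂μ) := by gcongr; exact lower x
          _ = _ := by ring
    _ = D₁ * ∫⁻ z, a z * ∫⁻ x in Metric.ball z R, Φ x ∂μ ∂μ := by
        rw [lintegral_mul_setLIntegral_ball R ham hΦ, lintegral_const_mul' _ _ ENNReal.coe_ne_top]
    _ ≤ D₁ * ∫⁻ z, (K * a z) * ∫⁻ x in Metric.ball z (L * R), H x ∂μ ∂μ := by
        refine mul_le_mul' le_rfl (lintegral_mono fun z => ?_)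
        calc a z * ∫⁻ x in Metric.ball z R, Φ x ∂μ
            ≤ a z * (K * ∫⁻ x in Metric.ball z (L * R), H x ∂μ) := by gcongr; exact hle z
          _ = _ := by ring
    _ = D₁ * ∫⁻ y, H y * (K * ∫⁻ x in Metric.ball y (L * R), a x ∂μ) ∂μ := by
        rw [lintegral_mul_setLIntegral_ball _ (ham.const_mul K) hH]
        simp_rw [lintegral_const_mul K ham]
    _ ≤ D₁ * ∫⁻ y, H y * (K * D₂) ∂μ := by
        gcongr with y
        exact hD₂ R hR y
    _ = _ := by
        rw [lintegral_mul_const _ hH]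
        push_cast
        ring

/-- Under the Poincaré inequality, the energy of a Lipschitz function is bounded at every scale by
the integral of any measurable majorant of its pointwise Lipschitz constant. -/
theorem PoincareLip.exists_energyFun_le [BorelSpace X] [IsFiniteMeasure μ] {p : ℝ≥0∞}
    (hq : 1 ≤ p.toReal)
    (hd : IsDoubling μ) (h : PoincareLip p μ) :
    ∃ C : ℝ≥0, ∀ g : X → ℝ, (∃ K, LipschitzWith K g) → ∀ H : X → ℝ≥0∞, Measurable H →
      (∀ x, pointwiseLip g x ≤ H x) → ∀ R : ℝ, 0 < R →
      energyFun p.toReal μ R g ≤ C * ∫⁻ x, H x ^ p.toReal ∂μ := by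
  obtain ⟨C, lam, hlam, hP⟩ := h
  set q := p.toReal with hqdef
  have hq0 : 0 < q := by linarith
  obtain ⟨D, hD⟩ := hd.exists_measure_ball_le 3
  obtain ⟨D', hD'⟩ := hd.exists_lintegral_le_of_ball (L := 2 * lam) (by linarith)
  have hp : ∀ x, ∀ s : ℝ, 0 < s → μ (Metric.ball x s) ≠ 0 := fun x s hs =>
    (hd.measure_ball_pos x hs).ne'
  have hf : ∀ x, ∀ s : ℝ, μ (Metric.ball x s) ≠ ∞ := fun x s => (hd.measure_ball_lt_top x s).ne
  -- `D` comes from enlarging `B(x, R)` to `B(z, 2R)`, `2 ^ (q - 1)` from convexity, `2` from two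
  -- copies of `J`, and `C * 2 ^ q` from Poincaré at radius `2R`.
  set K₀ : ℝ≥0∞ := D * 2 ^ (q - 1) * (2 * (C * 2 ^ q)) with hK₀
  have hK₀t : (D' : ℝ≥0∞) * K₀ ≠ ∞ := by
    have h1 : (2 : ℝ≥0∞) ^ (q - 1) ≠ ∞ := ENNReal.rpow_ne_top_of_nonneg (by linarith) (by simp)
    have h2 : (2 : ℝ≥0∞) ^ q ≠ ∞ := ENNReal.rpow_ne_top_of_nonneg (by linarith) (by simp)
    finiteness
  refine ⟨((D' : ℝ≥0∞) * K₀).toNNReal, fun g hg H hH hgH R hR => ?_⟩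
  rw [ENNReal.coe_toNNReal hK₀t]
  have hgc : Continuous g := hg.choose_spec.continuous
  have hgm : Measurable g := hgc.measurable
  have hΦm : Measurable fun x => ⨍⁻ y in Metric.ball x R, ‖g y - g x‖ₑ ^ q ∂μ :=
    measurable_setLAverage_ball R (F := fun x y => ‖g y - g x‖ₑ ^ q) (by
      unfold Function.uncurry; fun_prop)
  have main := hD' R hR (K₀ * ENNReal.ofReal R ^ q) _ (fun x => H x ^ q) hΦm (by fun_prop) ?_
  · have e1 : ENNReal.ofReal R ^ q ≠ 0 := by
      simp [ENNReal.rpow_eq_zero_iff, hR, hq0.not_gt]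
    have e2 : ENNReal.ofReal R ^ q ≠ ∞ :=
      ENNReal.rpow_ne_top_of_nonneg hq0.le ENNReal.ofReal_ne_top
    calc energyFun q μ R g
        ≤ (ENNReal.ofReal R ^ q)⁻¹ * (D' * (K₀ * ENNReal.ofReal R ^ q) * ∫⁻ x, H x ^ q ∂μ) := by
          unfold energyFun
          gcongr
      _ = ((ENNReal.ofReal R ^ q)⁻¹ * ENNReal.ofReal R ^ q) * (D' * K₀ * ∫⁻ x, H x ^ q ∂μ) := by
          ring
      _ = _ := by rw [ENNReal.inv_mul_cancel e1 e2, one_mul]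
  intro z
  have h2R : 0 < 2 * R := by positivity
  -- One constant serves every `x ∈ B(z, R)`, because `B(x, R) ⊆ B(z, 2R)`.
  set c := ⨍ w in Metric.ball z (2 * R), g w ∂μ with hc
  set J := ∫⁻ y in Metric.ball z (2 * R), ‖g y - c‖ₑ ^ q ∂μ with hJ
  have hJle : J ≤ C * 2 ^ q * ENNReal.ofReal R ^ q
      * ∫⁻ x in Metric.ball z (2 * lam * R), H x ^ q ∂μ := by
    calc J ≤ C * ENNReal.ofReal (2 * R) ^ q *
          ∫⁻ y in Metric.ball z (lam * (2 * R)), pointwiseLip g y ^ q ∂μ := hP g hg z (2 * R) h2R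
      _ ≤ C * ENNReal.ofReal (2 * R) ^ q *
          ∫⁻ y in Metric.ball z (lam * (2 * R)), H y ^ q ∂μ := by
          gcongr with y
          exact hgH y
      _ = _ := by
          rw [ENNReal.ofReal_mul zero_le_two, ENNReal.mul_rpow_of_nonneg _ _ hq0.le,
            show lam * (2 * R) = 2 * lam * R by ring]
          simp only [ENNReal.ofReal_ofNat]
          ring
  have hgm' : Measurable fun y => ‖g y - c‖ₑ ^ q := by fun_prop
  have hpt : ∀ x ∈ Metric.ball z R, ⨍⁻ y in Metric.ball x R, ‖g y - g x‖ₑ ^ q ∂μ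
      ≤ D * 2 ^ (q - 1) * (J / μ (Metric.ball z (2 * R)) + ‖g x - c‖ₑ ^ q) := by
    intro x hx
    have hx' := Metric.mem_ball.1 hx
    calc ⨍⁻ y in Metric.ball x R, ‖g y - g x‖ₑ ^ q ∂μ
        ≤ D * ⨍⁻ y in Metric.ball z (2 * R), ‖g y - g x‖ₑ ^ q ∂μ := by
          refine setLAverage_le_mul_setLAverage
            (Metric.ball_subset_ball' (by linarith)) (hp _ _ hR) (hf _ _)
            (hD z x R (2 * R) hR ?_) _
          rw [dist_comm]
          linarith
      _ ≤ D * ⨍⁻ y in Metric.ball z (2 * R),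
            2 ^ (q - 1) * (‖g y - c‖ₑ ^ q + ‖g x - c‖ₑ ^ q) ∂μ := by
          refine mul_le_mul' le_rfl ?_
          exact lintegral_mono fun y => enorm_sub_rpow_le hq (g y) (g x) c
      _ = _ := by
          rw [setLAverage_eq, lintegral_const_mul _ (by fun_prop), lintegral_add_left hgm',
            setLIntegral_const, mul_div_assoc, ENNReal.add_div,
            ENNReal.mul_div_cancel_right (hp z _ h2R) (hf z _), mul_assoc]
  calc ∫⁻ x in Metric.ball z R, ⨍⁻ y in Metric.ball x R, ‖g y - g x‖ₑ ^ q ∂μ ∂μ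
      ≤ ∫⁻ x in Metric.ball z R,
          D * 2 ^ (q - 1) * (J / μ (Metric.ball z (2 * R)) + ‖g x - c‖ₑ ^ q) ∂μ :=
        setLIntegral_mono (by fun_prop) hpt
    _ = D * 2 ^ (q - 1) * (J / μ (Metric.ball z (2 * R)) * μ (Metric.ball z R)
          + ∫⁻ x in Metric.ball z R, ‖g x - c‖ₑ ^ q ∂μ) := by
        rw [lintegral_const_mul _ (by fun_prop), lintegral_add_left measurable_const,
          setLIntegral_const]
    _ ≤ D * 2 ^ (q - 1) * (J + J) := by
        have hsub : Metric.ball z R ⊆ Metric.ball z (2 * R) :=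
          Metric.ball_subset_ball (by linarith)
        refine mul_le_mul' le_rfl (add_le_add ?_ ?_)
        · calc J / μ (Metric.ball z (2 * R)) * μ (Metric.ball z R)
              ≤ J / μ (Metric.ball z (2 * R)) * μ (Metric.ball z (2 * R)) := by gcongr
            _ = J := ENNReal.div_mul_cancel (hp z _ h2R) (hf z _)
        · exact lintegral_mono_set hsub
    _ = D * 2 ^ (q - 1) * 2 * J := by ring
    _ ≤ D * 2 ^ (q - 1) * 2 * (C * 2 ^ q * ENNReal.ofReal R ^ q
      * ∫⁻ x in Metric.ball z (2 * lam * R), H x ^ q ∂μ) := by gcongr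
    _ = _ := by rw [hK₀]; ring

end

/-! ### Lipschitz approximation by tent averages. -/

section


/-- The tent kernel `max 0 (s - d(x, y))` of width `s`. -/
noncomputable def tent {X : Type*} [PseudoMetricSpace X] (s : ℝ) (x y : X) : ℝ := max 0 (s - dist x y)

/-- Integration against the tent kernel of width `s`. -/
noncomputable def tentIntegral {X : Type*} [PseudoMetricSpace X] [MeasurableSpace X] (μ : Measure X) (s : ℝ)
    (u : X → ℝ) (x : X) : ℝ := ∫ y, tent s x y * u y ∂μ

section Tent

variable {X : Type*} [PseudoMetricSpace X]

theorem tent_nonneg (s : ℝ) (x y : X) : 0 ≤ tent s x y := le_max_left _ _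

theorem tent_le {s : ℝ} (hs : 0 ≤ s) (x y : X) : tent s x y ≤ s :=
  max_le hs (by linarith [dist_nonneg (x := x) (y := y)])

theorem tent_eq_zero {s : ℝ} {x y : X} (h : y ∉ Metric.ball x s) : tent s x y = 0 := by
  rw [Metric.mem_ball', not_lt] at h
  exact max_eq_left (by linarith)

theorem le_tent {s t : ℝ} {x y : X} (h : y ∈ Metric.ball x t) : s - t ≤ tent s x y := by
  rw [Metric.mem_ball'] at h
  exact le_max_of_le_right (by linarith)

theorem abs_tent_sub_tent_le (s : ℝ) (x x' y : X) : |tent s x y - tent s x' y| ≤ dist x x' := by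
  have h := abs_max_sub_max_le_abs (s - dist x y) (s - dist x' y) 0
  rw [max_comm, max_comm (s - dist x' y)] at h
  refine h.trans ?_
  rw [sub_sub_sub_cancel_left, abs_sub_comm]
  exact abs_dist_sub_le x x' y

theorem continuous_tent (s : ℝ) (x : X) : Continuous (tent s x) := by
  unfold tent
  fun_prop

variable [MeasurableSpace X] {μ : Measure X}

/-- The set `S` is free so that estimates at nearby centres can share one integral. -/
theorem abs_tentIntegral_le {s : ℝ} (hs : 0 ≤ s) {x : X} {S : Set X}
    (hx : Metric.ball x s ⊆ S) {u : X → ℝ} (hu : Integrable u μ) :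
    |tentIntegral μ s u x| ≤ s * ∫ y in S, |u y| ∂μ := by
  have h0 : tentIntegral μ s u x = ∫ y in S, tent s x y * u y ∂μ := by
    rw [setIntegral_eq_integral_of_forall_compl_eq_zero]
    · rfl
    · intro y hy
      rw [tent_eq_zero fun h => hy (hx h), zero_mul]
  rw [h0, ← integral_const_mul, ← Real.norm_eq_abs]
  refine norm_integral_le_of_norm_le (hu.abs.integrableOn (s := S) |>.const_mul _)
    (ae_of_all _ fun y => ?_)
  rw [Real.norm_eq_abs, abs_mul, abs_of_nonneg (tent_nonneg s x y)]
  gcongr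
  exact tent_le hs x y

variable [OpensMeasurableSpace X]

theorem integrable_tent_mul {s : ℝ} (hs : 0 ≤ s) (x : X) {u : X → ℝ} (hu : Integrable u μ) :
    Integrable (fun y => tent s x y * u y) μ := by
  refine hu.bdd_mul (c := s) (continuous_tent s x).measurable.aestronglyMeasurable
    (ae_of_all _ fun y => ?_)
  rw [Real.norm_of_nonneg (tent_nonneg s x y)]
  exact tent_le hs x y

theorem abs_tentIntegral_sub_le {s : ℝ} (hs : 0 ≤ s) {x x' : X} {S : Set X}
    (hx : Metric.ball x s ⊆ S) (hx' : Metric.ball x' s ⊆ S) {u : X → ℝ} (hu : Integrable u μ) :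
    |tentIntegral μ s u x - tentIntegral μ s u x'| ≤ dist x x' * ∫ y in S, |u y| ∂μ := by
  have h0 : tentIntegral μ s u x - tentIntegral μ s u x'
      = ∫ y in S, (tent s x y - tent s x' y) * u y ∂μ := by
    rw [setIntegral_eq_integral_of_forall_compl_eq_zero]
    · simp_rw [sub_mul]
      exact (integral_sub (integrable_tent_mul hs x hu) (integrable_tent_mul hs x' hu)).symm
    · intro y hy
      rw [tent_eq_zero fun h => hy (hx h), tent_eq_zero fun h => hy (hx' h), sub_zero, zero_mul]
  rw [h0, ← integral_const_mul, ← Real.norm_eq_abs]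
  refine norm_integral_le_of_norm_le (hu.abs.integrableOn (s := S) |>.const_mul _)
    (ae_of_all _ fun y => ?_)
  rw [Real.norm_eq_abs, abs_mul]
  gcongr
  exact abs_tent_sub_tent_le s x x' y

theorem le_tentIntegral_one [IsFiniteMeasure μ] {s : ℝ} (hs : 0 ≤ s) (x : X) :
    s / 2 * μ.real (Metric.ball x (s / 2)) ≤ tentIntegral μ s (fun _ => 1) x := by
  have hi := integrable_tent_mul (μ := μ) hs x (integrable_const (1 : ℝ))
  calc s / 2 * μ.real (Metric.ball x (s / 2)) = ∫ y in Metric.ball x (s / 2), s / 2 ∂μ := by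
        rw [setIntegral_const, smul_eq_mul, mul_comm]
    _ ≤ ∫ y in Metric.ball x (s / 2), tent s x y * 1 ∂μ := by
        refine setIntegral_mono_on (integrable_const _) hi.integrableOn
          Metric.isOpen_ball.measurableSet fun y hy => ?_
        linarith [le_tent (s := s) hy]
    _ ≤ _ := setIntegral_le_integral hi (ae_of_all _ fun y => by
        simpa using tent_nonneg s x y)

/-- Turns the tent average minus `f x` into a tent average of `f - f x`, where oscillation appears.
-/
theorem tentIntegral_sub_const [IsFiniteMeasure μ] {s : ℝ} (hs : 0 ≤ s) (x : X) {u : X → ℝ}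
    (hu : Integrable u μ) (c : ℝ) :
    tentIntegral μ s (fun y => u y - c) x
      = tentIntegral μ s u x - c * tentIntegral μ s (fun _ => 1) x := by
  unfold tentIntegral
  rw [← integral_const_mul, ← integral_sub (integrable_tent_mul hs x hu)
    ((integrable_tent_mul hs x (integrable_const 1)).const_mul c)]
  congr 1 with y
  ring

end Tent

/-- Only the numerator `N` at the base point has to be bounded, not `N'`. -/
theorem abs_div_sub_div_le {N N' w w' m : ℝ} (hm : 0 < m) (hw : m ≤ w) (hw' : m ≤ w') :
    |N' / w' - N / w| ≤ |N' - N| / m + |N| * |w' - w| / m ^ 2 := by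
  have h1 : 0 < w := hm.trans_le hw
  have h2 : 0 < w' := hm.trans_le hw'
  have e : N' / w' - N / w = (N' - N) / w' - N * (w' - w) / (w * w') := by
    field_simp
    ring
  rw [e]
  refine (abs_sub _ _).trans ?_
  rw [abs_div, abs_div, abs_mul, abs_mul, abs_of_pos h1, abs_of_pos h2]
  gcongr
  rw [pow_two]
  gcongr

variable {X : Type*} [PseudoMetricSpace X] [CompactSpace X] [MeasurableSpace X]
  [OpensMeasurableSpace X] {μ : Measure X}

/-- The normalised tent average of an integrable function is Lipschitz. -/
theorem IsDoubling.exists_lipschitzWith_tent_average [IsFiniteMeasure μ] (hd : IsDoubling μ)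
    {s : ℝ} (hs : 0 < s) {f : X → ℝ} (hf : Integrable f μ) :
    ∃ K, LipschitzWith K fun x => tentIntegral μ s f x / tentIntegral μ s (fun _ => 1) x := by
  rcases isEmpty_or_nonempty X with hX | hX
  · exact ⟨0, fun x => hX.elim x⟩
  set w := tentIntegral μ s (fun _ : X => (1 : ℝ)) with hw
  have hwl : ∀ x x', |w x - w x'| ≤ dist x x' * ∫ y in Set.univ, |(1 : ℝ)| ∂μ := fun x x' =>
    abs_tentIntegral_sub_le hs.le (Set.subset_univ _) (Set.subset_univ _) (integrable_const 1)
  have hwc : Continuous w := by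
    refine (LipschitzWith.of_dist_le_mul (K := (∫ y in Set.univ, |(1 : ℝ)| ∂μ).toNNReal)
      fun x x' => ?_).continuous
    rw [Real.coe_toNNReal _ (integral_nonneg fun _ => abs_nonneg _), Real.dist_eq, mul_comm]
    exact hwl x x'
  -- Compactness keeps the denominator away from zero.
  obtain ⟨x₀, -, hx₀⟩ := isCompact_univ.exists_isMinOn Set.univ_nonempty hwc.continuousOn
  have hm : 0 < w x₀ := by
    refine lt_of_lt_of_le ?_ (le_tentIntegral_one hs.le x₀)
    have := ENNReal.toReal_pos (hd.measure_ball_pos x₀ (half_pos hs)).ne' (measure_ne_top _ _)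
    rw [Measure.real]
    positivity
  have hmin : ∀ x, w x₀ ≤ w x := fun x => hx₀ (Set.mem_univ x)
  set I := ∫ y in Set.univ, |f y| ∂μ
  set V := ∫ y in Set.univ, |(1 : ℝ)| ∂μ
  have hI : 0 ≤ I := integral_nonneg fun _ => abs_nonneg _
  have hV : 0 ≤ V := integral_nonneg fun _ => abs_nonneg _
  refine ⟨(I / w x₀ + s * I * V / w x₀ ^ 2).toNNReal, LipschitzWith.of_dist_le_mul
    fun x x' => ?_⟩
  rw [Real.coe_toNNReal _ (by positivity), Real.dist_eq]
  refine (abs_div_sub_div_le hm (hmin x') (hmin x)).trans ?_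
  have h1 : |tentIntegral μ s f x - tentIntegral μ s f x'| ≤ dist x x' * I :=
    abs_tentIntegral_sub_le hs.le (Set.subset_univ _) (Set.subset_univ _) hf
  have h2 : |tentIntegral μ s f x'| ≤ s * I := abs_tentIntegral_le hs.le (Set.subset_univ _) hf
  calc _ ≤ dist x x' * I / w x₀ + s * I * (dist x x' * V) / w x₀ ^ 2 := by
        gcongr
        exact hwl x x'
    _ = _ := by ring

/-- Lipschitz approximation at scale `r`: both the error and the pointwise Lipschitz constant are
controlled by the mean oscillation on balls of radius `r`. -/
theorem IsDoubling.exists_lipschitz_approx [IsFiniteMeasure μ] (hd : IsDoubling μ) :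
    ∃ C : ℝ≥0, ∀ r : ℝ, 0 < r → ∀ f : X → ℝ, Integrable f μ →
      ∃ g : X → ℝ, (∃ K, LipschitzWith K g) ∧
        (∀ x, ‖f x - g x‖ₑ ≤ C * ⨍⁻ y in Metric.ball x r, ‖f y - f x‖ₑ ∂μ) ∧
        ∀ x, pointwiseLip g x
          ≤ C * (ENNReal.ofReal r)⁻¹ * ⨍⁻ y in Metric.ball x r, ‖f y - f x‖ₑ ∂μ := by
  -- Used with radii `r`, `r / 4` and centres closer than `r / 2`: `r + r / 2 = 6 * (r / 4)`.
  obtain ⟨D, hD⟩ := hd.exists_measure_ball_le 6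
  -- Width `r / 2` keeps the tents centred within `r / 2` of `x` inside `B(x, r)`. With `m = r V /
  -- (4 D)` below, the term `I / m` gives `4 * D` and `(r / 2) I V / m ^ 2` gives `8 * D ^ 2`, each
  -- times `I / (r V)`.
  refine ⟨8 * D ^ 2 + 4 * D, fun r hr f hf => ⟨_, hd.exists_lipschitzWith_tent_average
    (half_pos hr) hf, ?_⟩⟩
  have hr2 := (half_pos hr)
  set w := tentIntegral μ (r / 2) (fun _ : X => (1 : ℝ)) with hw
  set g := fun x => tentIntegral μ (r / 2) f x / w x with hg
  rw [← forall_and]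
  intro x
  set V := μ.real (Metric.ball x r) with hV
  set I := ∫ y in Metric.ball x r, |f y - f x| ∂μ with hI
  have hI0 : 0 ≤ I := integral_nonneg fun _ => abs_nonneg _
  have hV0 : 0 < V := ENNReal.toReal_pos (hd.measure_ball_pos x hr).ne' (measure_ne_top _ _)
  have hfx : Integrable (fun y => f y - f x) μ := hf.sub (integrable_const _)
  have hA : ⨍⁻ y in Metric.ball x r, ‖f y - f x‖ₑ ∂μ = ENNReal.ofReal (I / V) := by
    rw [setLAverage_eq, ENNReal.ofReal_div_of_pos hV0, hV, ofReal_measureReal, hI]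
    congr 1
    exact (ofReal_integral_norm_eq_lintegral_enorm hfx.integrableOn).symm
  have hV' : ∀ x', dist x x' < r / 2 → V ≤ D * μ.real (Metric.ball x' (r / 4)) := by
    intro x' hx'
    have := hD x x' (r / 4) r (by positivity) (by linarith)
    have h2 := ENNReal.toReal_mono (by finiteness) this
    rw [ENNReal.toReal_mul, ENNReal.coe_toReal] at h2
    exact h2
  have hD0 : 0 < (D : ℝ) := by
    have h1 := hV' x (by simpa using hr)
    have h2 : (0 : ℝ) ≤ D := D.2
    rcases h2.eq_or_lt with h | h
    · rw [← h, zero_mul] at h1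
      linarith
    · exact h
  set m := r * V / (4 * D) with hm
  have hm0 : 0 < m := by positivity
  have hwm : ∀ x', dist x x' < r / 2 → m ≤ w x' := by
    intro x' hx'
    refine le_trans ?_ (le_tentIntegral_one hr2.le x')
    rw [hm, div_le_iff₀ (by positivity)]
    have h1 := hV' x' hx'
    rw [show r / 2 / 2 = r / 4 by ring]
    nlinarith
  have hxm : m ≤ w x := hwm x (by simpa using hr)
  have hg' : ∀ x', dist x x' < r / 2 →
      g x' - f x = tentIntegral μ (r / 2) (fun y => f y - f x) x' / w x' := by
    intro x' hx'
    have := hm0.trans_le (hwm x' hx')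
    rw [tentIntegral_sub_const hr2.le x' hf, sub_div, mul_div_cancel_right₀ _ this.ne']
  have hTx : |tentIntegral μ (r / 2) (fun y => f y - f x) x| ≤ r / 2 * I :=
    abs_tentIntegral_le hr2.le (Metric.ball_subset_ball (by linarith)) hfx
  constructor
  · rw [hA, ← ofReal_norm, ← ENNReal.ofReal_coe_nnreal,
      ← ENNReal.ofReal_mul (NNReal.coe_nonneg _)]
    refine ENNReal.ofReal_le_ofReal ?_
    rw [Real.norm_eq_abs, abs_sub_comm, hg' x (by simpa using hr), abs_div,
      abs_of_pos (hm0.trans_le hxm)]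
    calc _ ≤ r / 2 * I / m := by gcongr
      _ = 2 * D * (I / V) := by
          rw [hm]
          field_simp
          ring
      _ ≤ _ := by
          push_cast
          gcongr
          nlinarith
  · set L := (8 * (D : ℝ) ^ 2 + 4 * D) * r⁻¹ * (I / V) with hL
    have hL0 : 0 ≤ L := by positivity
    have hgx : ∀ x', dist x' x < r / 2 → |g x' - g x| ≤ L * dist x' x := by
      intro x' hx'
      rw [dist_comm] at hx'
      have h1 : |tentIntegral μ (r / 2) (fun y => f y - f x) x'
          - tentIntegral μ (r / 2) (fun y => f y - f x) x| ≤ dist x' x * I :=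
        abs_tentIntegral_sub_le hr2.le (Metric.ball_subset_ball' (by rw [dist_comm]; linarith))
          (Metric.ball_subset_ball (by linarith)) hfx
      have h2 : |w x' - w x| ≤ dist x' x * ∫ y in Metric.ball x r, |(1 : ℝ)| ∂μ :=
        abs_tentIntegral_sub_le hr2.le (Metric.ball_subset_ball' (by rw [dist_comm]; linarith))
          (Metric.ball_subset_ball (by linarith)) (integrable_const _)
      have h3 : ∫ y in Metric.ball x r, |(1 : ℝ)| ∂μ = V := by simp [hV]
      rw [h3] at h2
      rw [← sub_sub_sub_cancel_right (g x') (g x) (f x), hg' x' hx', hg' x (by simpa using hr)]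
      refine (abs_div_sub_div_le hm0 hxm (hwm x' hx')).trans ?_
      calc _ ≤ dist x' x * I / m + r / 2 * I * (dist x' x * V) / m ^ 2 := by gcongr
        _ = _ := by
            rw [hm, hL]
            field_simp
            ring
    have hcoe : ((8 * D ^ 2 + 4 * D : ℝ≥0) : ℝ≥0∞) * (ENNReal.ofReal r)⁻¹
        * ENNReal.ofReal (I / V) = ENNReal.ofReal L := by
      rw [← ENNReal.ofReal_inv_of_pos hr, ← ENNReal.ofReal_coe_nnreal,
        ← ENNReal.ofReal_mul (NNReal.coe_nonneg _), ← ENNReal.ofReal_mul (by positivity), hL]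
      push_cast
      rfl
    rw [hA, hcoe]
    refine limsup_le_of_le (by isBoundedDefault) ?_
    filter_upwards [Ioo_mem_nhdsGT hr2] with ρ hρ
    refine iSup₂_le fun x' hx' => ?_
    have hx'' : dist x' x ≤ ρ := hx'
    refine ENNReal.div_le_of_le_mul ?_
    rw [← ofReal_norm, ← ENNReal.ofReal_mul hL0]
    refine ENNReal.ofReal_le_ofReal ?_
    exact (hgx x' (hx''.trans_lt hρ.2)).trans (by gcongr)

end

/-! ### Almost monotonicity of the energies. -/

section


variable {X : Type*} [PseudoMetricSpace X] [MeasurableSpace X]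
  [OpensMeasurableSpace X] [SecondCountableTopology X] {μ : Measure X} [IsFiniteMeasure μ]

/-- By Tonelli, `ψ y` is weighted by the integral of `1 / μ(B(x, R))` over `x ∈ B(y, R)`, which
doubling bounds. -/
theorem lintegral_setLAverage_ball_le (h : IsDoubling μ) :
    ∃ D : ℝ≥0, ∀ R : ℝ, 0 < R → ∀ ψ : X → ℝ≥0∞, Measurable ψ →
      ∫⁻ x, ⨍⁻ y in Metric.ball x R, ψ y ∂μ ∂μ ≤ D * ∫⁻ x, ψ x ∂μ := by
  obtain ⟨D, hD⟩ := h.exists_setLIntegral_inv_measure_ball_le one_pos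
  refine ⟨D, fun R hR ψ hψ => ?_⟩
  calc ∫⁻ x, ⨍⁻ y in Metric.ball x R, ψ y ∂μ ∂μ
      = ∫⁻ x, (μ (Metric.ball x R))⁻¹ * ∫⁻ y in Metric.ball x R, ψ y ∂μ ∂μ := by
        simp_rw [setLAverage_eq, div_eq_mul_inv, mul_comm]
    _ = ∫⁻ y, ψ y * ∫⁻ x in Metric.ball y R, (μ (Metric.ball x R))⁻¹ ∂μ ∂μ :=
        lintegral_mul_setLIntegral_ball R (measurable_measure_ball R).inv hψ
    _ ≤ ∫⁻ y, ψ y * D ∂μ := by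
        refine lintegral_mono fun y => mul_le_mul' le_rfl ?_
        simpa using hD R hR y
    _ = _ := by rw [lintegral_mul_const _ hψ, mul_comm]

theorem energyFun_le_add {q : ℝ} (hq : 1 ≤ q) (r : ℝ) (f : X → ℝ) {g : X → ℝ}
    (hg : Measurable g) :
    energyFun q μ r f
      ≤ 2 ^ (q - 1) * (energyFun q μ r g + energyFun q μ r (fun x => f x - g x)) := by
  have hm : Measurable fun x => ⨍⁻ y in Metric.ball x r, ‖g y - g x‖ₑ ^ q ∂μ :=
    measurable_setLAverage_ball r (F := fun x y => ‖g y - g x‖ₑ ^ q) (by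
      unfold Function.uncurry; fun_prop)
  have hc : (2 : ℝ≥0∞) ^ (q - 1) ≠ ∞ := ENNReal.rpow_ne_top_of_nonneg (by linarith) (by simp)
  calc energyFun q μ r f
      ≤ (ENNReal.ofReal r ^ q)⁻¹ * ∫⁻ x, 2 ^ (q - 1) * (⨍⁻ y in Metric.ball x r, ‖g y - g x‖ₑ ^ q ∂μ
          + ⨍⁻ y in Metric.ball x r, ‖(f y - g y) - (f x - g x)‖ₑ ^ q ∂μ) ∂μ := by
        refine mul_le_mul' le_rfl (lintegral_mono fun x => ?_)
        have hgx : Measurable fun y => ‖g y - g x‖ₑ ^ q := by fun_prop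
        rw [laverage_eq', laverage_eq', laverage_eq', ← lintegral_add_left hgx,
          ← lintegral_const_mul' _ _ hc]
        refine lintegral_mono fun y => ?_
        refine le_trans (ENNReal.rpow_le_rpow ?_ (by linarith))
          (ENNReal.rpow_add_le_mul_rpow_add_rpow _ _ hq)
        calc ‖f y - f x‖ₑ = ‖(g y - g x) + ((f y - g y) - (f x - g x))‖ₑ := by congr 1; ring
          _ ≤ _ := enorm_add_le _ _
    _ = _ := by
        rw [lintegral_const_mul' _ _ hc, lintegral_add_left hm]
        unfold energyFun
        ring

/-- Meant for errors whose `L^q` norm is already small compared with `R`. -/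
theorem IsDoubling.exists_energyFun_le_lintegral (h : IsDoubling μ) {q : ℝ} (hq : 1 ≤ q) :
    ∃ C : ℝ≥0, ∀ R : ℝ, 0 < R → ∀ u : X → ℝ, Measurable u →
      energyFun q μ R u ≤ C * (ENNReal.ofReal R ^ q)⁻¹ * ∫⁻ x, ‖u x‖ₑ ^ q ∂μ := by
  obtain ⟨D, hD⟩ := lintegral_setLAverage_ball_le h
  have hc : (2 : ℝ≥0∞) ^ (q - 1) ≠ ∞ := ENNReal.rpow_ne_top_of_nonneg (by linarith) (by simp)
  refine ⟨((2 : ℝ≥0∞) ^ (q - 1)).toNNReal * (D + 1), fun R hR u hu => ?_⟩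
  push_cast
  rw [ENNReal.coe_toNNReal hc]
  have hu' : Measurable fun y => ‖u y‖ₑ ^ q := by fun_prop
  have hm : Measurable fun x => ⨍⁻ y in Metric.ball x R, ‖u y‖ₑ ^ q ∂μ :=
    measurable_setLAverage_ball R (F := fun x y => ‖u y‖ₑ ^ q) (by
      unfold Function.uncurry; fun_prop)
  have hle : ∫⁻ x, ⨍⁻ y in Metric.ball x R, ‖u y - u x‖ₑ ^ q ∂μ ∂μ
      ≤ 2 ^ (q - 1) * (D + 1) * ∫⁻ x, ‖u x‖ₑ ^ q ∂μ := by
    calc ∫⁻ x, ⨍⁻ y in Metric.ball x R, ‖u y - u x‖ₑ ^ q ∂μ ∂μ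
        ≤ ∫⁻ x, 2 ^ (q - 1) * (⨍⁻ y in Metric.ball x R, ‖u y‖ₑ ^ q ∂μ + ‖u x‖ₑ ^ q) ∂μ := by
          refine lintegral_mono fun x => ?_
          calc ⨍⁻ y in Metric.ball x R, ‖u y - u x‖ₑ ^ q ∂μ
              ≤ ⨍⁻ y in Metric.ball x R, 2 ^ (q - 1) * (‖u y‖ₑ ^ q + ‖u x‖ₑ ^ q) ∂μ := by
                refine lintegral_mono fun y => ?_
                simpa using enorm_sub_rpow_le hq (u y) (u x) 0
            _ = _ := by
                rw [setLAverage_eq, setLAverage_eq, lintegral_const_mul' _ _ hc,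
                  lintegral_add_left hu', setLIntegral_const, mul_div_assoc, ENNReal.add_div,
                  ENNReal.mul_div_cancel_right (h.measure_ball_pos x hR).ne' (measure_ne_top _ _)]
      _ = 2 ^ (q - 1) * (∫⁻ x, ⨍⁻ y in Metric.ball x R, ‖u y‖ₑ ^ q ∂μ ∂μ
            + ∫⁻ x, ‖u x‖ₑ ^ q ∂μ) := by
          rw [lintegral_const_mul' _ _ hc, lintegral_add_left hm]
      _ ≤ 2 ^ (q - 1) * (D * ∫⁻ x, ‖u x‖ₑ ^ q ∂μ + ∫⁻ x, ‖u x‖ₑ ^ q ∂μ) := by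
          gcongr
          exact hD R hR _ hu'
      _ = _ := by ring
  calc energyFun q μ R u
      ≤ (ENNReal.ofReal R ^ q)⁻¹ * (2 ^ (q - 1) * (D + 1) * ∫⁻ x, ‖u x‖ₑ ^ q ∂μ) :=
        mul_le_mul' le_rfl hle
    _ = _ := by ring

/-- Almost monotonicity of the energies: up to a constant, the energy at a smaller scale controls
the energy at every larger scale. -/
theorem PoincareLip.exists_energyFun_le_energyFun [BorelSpace X] [CompactSpace X] {p : ℝ≥0∞}
    (hq : 1 ≤ p.toReal) (hd : IsDoubling μ) (h : PoincareLip p μ) :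
    ∃ C : ℝ≥0, ∀ r R : ℝ, 0 < r → r ≤ R → ∀ f : X → ℝ, Measurable f → Integrable f μ →
      energyFun p.toReal μ R f ≤ C * energyFun p.toReal μ r f := by
  obtain ⟨C₁, hC₁⟩ := hd.exists_lipschitz_approx
  obtain ⟨C₂, hC₂⟩ := h.exists_energyFun_le hq hd
  obtain ⟨C₃, hC₃⟩ := hd.exists_energyFun_le_lintegral hq
  set q := p.toReal
  have hq0 : 0 ≤ q := by linarith
  have hc : (2 : ℝ≥0∞) ^ (q - 1) ≠ ∞ := ENNReal.rpow_ne_top_of_nonneg (by linarith) (by simp)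
  have hc₁ : (C₁ : ℝ≥0∞) ^ q ≠ ∞ := ENNReal.rpow_ne_top_of_nonneg hq0 (by simp)
  refine ⟨((2 : ℝ≥0∞) ^ (q - 1)).toNNReal * ((C₂ + C₃) * ((C₁ : ℝ≥0∞) ^ q).toNNReal),
    fun r R hr hrR f hf hfi => ?_⟩
  push_cast
  rw [ENNReal.coe_toNNReal hc, ENNReal.coe_toNNReal hc₁]
  obtain ⟨g, hgL, hfg, hgLip⟩ := hC₁ r hr f hfi
  have hR : 0 < R := hr.trans_le hrR
  have hgm : Measurable g := hgL.choose_spec.continuous.measurable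
  set A := fun x => ⨍⁻ y in Metric.ball x r, ‖f y - f x‖ₑ ∂μ with hA
  have hAm : Measurable A := measurable_setLAverage_ball r (F := fun x y => ‖f y - f x‖ₑ) (by
      unfold Function.uncurry; fun_prop)
  have hAq : ∫⁻ x, A x ^ q ∂μ ≤ ENNReal.ofReal r ^ q * energyFun q μ r f := by
    rw [mul_energyFun q hr hq0]
    refine lintegral_mono fun x => ?_
    exact laverage_rpow_le hq (by fun_prop)
  have e1 : ENNReal.ofReal r ^ q ≠ 0 := by
    simp [ENNReal.rpow_eq_zero_iff, hr, hq0.not_gt]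
  have e2 : ENNReal.ofReal r ^ q ≠ ∞ :=
    ENNReal.rpow_ne_top_of_nonneg hq0 ENNReal.ofReal_ne_top
  -- The factor `r^{-q}` from `Lip g` cancels the `r^q` in `hAq`; nothing depends on `R`.
  have hE : energyFun q μ R g ≤ C₂ * (C₁ ^ q * energyFun q μ r f) := by
    refine (hC₂ g hgL _ (hAm.const_mul _) hgLip R hR).trans (mul_le_mul' le_rfl ?_)
    calc ∫⁻ x, (C₁ * (ENNReal.ofReal r)⁻¹ * A x) ^ q ∂μ
        = C₁ ^ q * (ENNReal.ofReal r ^ q)⁻¹ * ∫⁻ x, A x ^ q ∂μ := by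
          rw [← lintegral_const_mul _ (by fun_prop)]
          simp_rw [ENNReal.mul_rpow_of_nonneg _ _ hq0, ENNReal.inv_rpow]
      _ ≤ C₁ ^ q * (ENNReal.ofReal r ^ q)⁻¹ * (ENNReal.ofReal r ^ q * energyFun q μ r f) := by
          gcongr
      _ = C₁ ^ q * energyFun q μ r f * ((ENNReal.ofReal r ^ q)⁻¹ * ENNReal.ofReal r ^ q) := by
          ring
      _ = _ := by rw [ENNReal.inv_mul_cancel e1 e2, mul_one]
  have hE' : energyFun q μ R (fun x => f x - g x) ≤ C₃ * (C₁ ^ q * energyFun q μ r f) := by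
    refine (hC₃ R hR _ (by fun_prop)).trans ?_
    rw [mul_assoc]
    refine mul_le_mul' le_rfl ?_
    -- This is where `r ≤ R` matters: `R^{-q} ≤ r^{-q}`.
    calc (ENNReal.ofReal R ^ q)⁻¹ * ∫⁻ x, ‖f x - g x‖ₑ ^ q ∂μ
        ≤ (ENNReal.ofReal r ^ q)⁻¹ * ∫⁻ x, (C₁ * A x) ^ q ∂μ := by
          gcongr with x
          exact hfg x
      _ = (ENNReal.ofReal r ^ q)⁻¹ * (C₁ ^ q * ∫⁻ x, A x ^ q ∂μ) := by
          simp_rw [ENNReal.mul_rpow_of_nonneg _ _ hq0]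
          rw [lintegral_const_mul' _ _ hc₁]
      _ ≤ (ENNReal.ofReal r ^ q)⁻¹ * (C₁ ^ q * (ENNReal.ofReal r ^ q * energyFun q μ r f)) := by
          gcongr
      _ = C₁ ^ q * energyFun q μ r f * ((ENNReal.ofReal r ^ q)⁻¹ * ENNReal.ofReal r ^ q) := by
          ring
      _ = _ := by rw [ENNReal.inv_mul_cancel e1 e2, mul_one]
  calc energyFun q μ R f
      ≤ 2 ^ (q - 1) * (energyFun q μ R g + energyFun q μ R (fun x => f x - g x)) :=
        energyFun_le_add hq R f hgm
    _ ≤ 2 ^ (q - 1) * (C₂ * (C₁ ^ q * energyFun q μ r f)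
          + C₃ * (C₁ ^ q * energyFun q μ r f)) := by gcongr
    _ = _ := by ring

end

/-! ### Finite rank averaging operators on `L^p`. -/

section


theorem Lp_coeFn_sum {α ι : Type*} [MeasurableSpace α] {ν : Measure α} {p : ℝ≥0∞} (t : Finset ι)
    (F : ι → Lp ℝ p ν) : ⇑(∑ i ∈ t, F i) =ᵐ[ν] fun x => ∑ i ∈ t, F i x := by
  classical
  induction t using Finset.induction_on with
  | empty =>
    simp only [Finset.sum_empty]
    exact Lp.coeFn_zero ℝ p ν
  | insert a s ha ih =>
    rw [Finset.sum_insert ha]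
    filter_upwards [ih, Lp.coeFn_add (F a) (∑ i ∈ s, F i)] with x h1 h2
    rw [h2, Finset.sum_insert ha, Pi.add_apply, h1]

theorem Lp_enorm_rpow {α : Type*} [MeasurableSpace α] {ν : Measure α} {p : ℝ≥0∞} (hp0 : p ≠ 0)
    (hp : p ≠ ∞) (f : Lp ℝ p ν) : ‖f‖ₑ ^ p.toReal = ∫⁻ x, ‖f x‖ₑ ^ p.toReal ∂ν := by
  rw [Lp.enorm_def, eLpNorm_eq_eLpNorm' hp0 hp,
    lintegral_rpow_enorm_eq_rpow_eLpNorm' (ENNReal.toReal_pos hp0 hp)]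

/-- Averaging over a set is a continuous linear functional on `L^p` of a finite measure. -/
theorem Lp_exists_setAverage {α : Type*} [MeasurableSpace α] {ν : Measure α} [IsFiniteMeasure ν]
    (p : ℝ≥0∞) [hp1 : Fact (1 ≤ p)] (s : Set α) :
    ∃ L : Lp ℝ p ν →L[ℝ] ℝ, ∀ f, L f = ⨍ x in s, f x ∂ν := by
  have hi : ∀ f : Lp ℝ p ν, Integrable f ν := fun f => (Lp.memLp f).integrable hp1.out
  set K : ℝ≥0∞ := ν Set.univ ^ (1 / (1 : ℝ≥0∞).toReal - 1 / p.toReal) with hK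
  have hKt : K ≠ ∞ := by
    refine ENNReal.rpow_ne_top_of_nonneg ?_ (measure_ne_top _ _)
    rcases eq_or_ne p ∞ with rfl | hp
    · simp
    · have : 1 ≤ p.toReal := by
        simpa using ENNReal.toReal_mono hp hp1.out
      simpa using inv_le_one_of_one_le₀ this
  let I : Lp ℝ p ν →ₗ[ℝ] ℝ :=
    { toFun := fun f => ∫ x in s, f x ∂ν
      map_add' := fun f g => by
        rw [← integral_add (hi f).integrableOn (hi g).integrableOn]
        exact integral_congr_ae (ae_restrict_of_ae (Lp.coeFn_add f g))
      map_smul' := fun c f => by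
        rw [RingHom.id_apply, smul_eq_mul, ← integral_const_mul]
        exact integral_congr_ae (ae_restrict_of_ae (Lp.coeFn_smul c f)) }
  have hI : ∀ f, ‖I f‖ ≤ K.toReal * ‖f‖ := by
    intro f
    have h1 : ‖I f‖ₑ ≤ ‖f‖ₑ * K := by
      calc ‖I f‖ₑ ≤ ∫⁻ x in s, ‖f x‖ₑ ∂ν := enorm_integral_le_lintegral_enorm _
        _ ≤ ∫⁻ x, ‖f x‖ₑ ∂ν := setLIntegral_le_lintegral _ _
        _ = eLpNorm f 1 ν := eLpNorm_one_eq_lintegral_enorm.symm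
        _ ≤ eLpNorm f p ν * K :=
          eLpNorm_le_eLpNorm_mul_rpow_measure_univ hp1.out (Lp.aestronglyMeasurable f)
        _ = _ := by rw [Lp.enorm_def]
    have h2 := ENNReal.toReal_mono (by finiteness) h1
    simpa [mul_comm] using h2
  refine ⟨(ν.real s)⁻¹ • I.mkContinuous _ hI, fun f => ?_⟩
  rw [setAverage_eq]
  rfl

variable {X : Type*} [PseudoMetricSpace X] [MeasurableSpace X]

/-- The nearest point among finitely many terms of a dense sequence; the fibres of `π` form a finite
measurable partition into small cells. -/
theorem exists_simpleFunc_dist_lt [OpensMeasurableSpace X] [CompactSpace X] {R : ℝ} (hR : 0 < R) :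
    ∃ π : SimpleFunc X X, ∀ x, dist (π x) x < R := by
  rcases isEmpty_or_nonempty X with hX | hX
  · exact ⟨SimpleFunc.ofIsEmpty, fun x => hX.elim x⟩
  · set e := TopologicalSpace.denseSeq X
    obtain ⟨t, ht⟩ := isCompact_univ.elim_finite_subcover (fun k => Metric.ball (e k) R)
      (fun _ => Metric.isOpen_ball) fun x _ => by
        obtain ⟨k, hk⟩ := (TopologicalSpace.denseRange_denseSeq X).exists_dist_lt x hR
        exact Set.mem_iUnion.2 ⟨k, hk⟩
    refine ⟨SimpleFunc.nearestPt e (t.sup id), fun x => ?_⟩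
    obtain ⟨k, hk, hxk⟩ := Set.mem_iUnion₂.1 (ht (Set.mem_univ x))
    have h1 := SimpleFunc.edist_nearestPt_le e x (Finset.le_sup (f := id) hk)
    rw [edist_dist, edist_dist] at h1
    have h2 := (ENNReal.ofReal_le_ofReal_iff dist_nonneg).1 h1
    exact h2.trans_lt (Metric.mem_ball'.1 hxk)

variable {μ : Measure X}

/-- Functions of finite energy are approximated by finite rank averaging operators. -/
theorem IsDoubling.exists_finite_rank_approx [OpensMeasurableSpace X] [CompactSpace X]
    [IsFiniteMeasure μ] {p : ℝ≥0∞} [hp1 : Fact (1 ≤ p)] (hp : p ≠ ∞)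
    (hd : IsDoubling μ) :
    ∃ C : ℝ≥0, ∀ R : ℝ, 0 < R → ∃ (t : Finset X) (L : X → Lp ℝ p μ →L[ℝ] ℝ) (e : X → Lp ℝ p μ),
      ∀ f, ‖f - ∑ c ∈ t, L c f • e c‖ₑ ^ p.toReal
        ≤ C * (ENNReal.ofReal R ^ p.toReal * energy p μ R f) := by
  have hq : 1 ≤ p.toReal := by simpa using ENNReal.toReal_mono hp hp1.out
  obtain ⟨D, hD⟩ := hd.exists_measure_ball_le 3
  refine ⟨D, fun R hR => ?_⟩
  obtain ⟨π, hπ⟩ := exists_simpleFunc_dist_lt (X := X) (half_pos hR)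
  choose L hL using fun c : X => Lp_exists_setAverage (ν := μ) p (Metric.ball c (R / 2))
  -- The operator assigns to each cell `π ⁻¹' {c}` the mean of `f` over `B(c, R / 2)`; for `x` in
  -- the cell that ball lies in `B(x, R)`.
  refine ⟨π.range, L, fun c => indicatorConstLp p (π.measurableSet_fiber c)
    (measure_ne_top μ _) (1 : ℝ), fun f => ?_⟩
  set q := p.toReal
  have hi : Integrable f μ := (Lp.memLp f).integrable hp1.out
  have hae : ∀ᵐ x ∂μ, (f - ∑ c ∈ π.range, L c f • indicatorConstLp p (π.measurableSet_fiber c)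
      (measure_ne_top μ _) (1 : ℝ)) x = f x - L (π x) f := by
    have h1 := Lp_coeFn_sum π.range fun c => L c f • indicatorConstLp p (π.measurableSet_fiber c)
      (measure_ne_top μ _) (1 : ℝ)
    have h2 : ∀ᵐ x ∂μ, ∀ c ∈ π.range, (L c f • indicatorConstLp p (π.measurableSet_fiber c)
        (measure_ne_top μ _) (1 : ℝ)) x = L c f * (π ⁻¹' {c}).indicator (fun _ => 1) x := by
      rw [eventually_all_finset]
      intro c _
      filter_upwards [Lp.coeFn_smul (L c f) (indicatorConstLp p (π.measurableSet_fiber c)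
        (measure_ne_top μ _) (1 : ℝ)), indicatorConstLp_coeFn (p := p)
        (hs := π.measurableSet_fiber c) (hμs := measure_ne_top μ _) (c := (1 : ℝ))] with x h3 h4
      rw [h3, Pi.smul_apply, h4, smul_eq_mul]
    filter_upwards [h1, h2, Lp.coeFn_sub f (∑ c ∈ π.range, L c f •
      indicatorConstLp p (π.measurableSet_fiber c) (measure_ne_top μ _) (1 : ℝ))] with x h1 h2 h3
    rw [h3, Pi.sub_apply, h1, Finset.sum_congr rfl h2,
      Finset.sum_eq_single_of_mem (π x) (π.mem_range_self x)]
    · simp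
    · intro c _ hc
      simp [hc.symm]
  rw [Lp_enorm_rpow (zero_lt_one.trans_le hp1.out).ne' hp]
  calc _ = ∫⁻ x, ‖f x - L (π x) f‖ₑ ^ q ∂μ :=
        lintegral_congr_ae (hae.mono fun x hx => by simp only [hx, q])
    _ ≤ ∫⁻ x, D * ⨍⁻ y in Metric.ball x R, ‖f y - f x‖ₑ ^ q ∂μ ∂μ := by
        refine lintegral_mono fun x => ?_
        have hpos := hd.measure_ball_pos (π x) (half_pos hR)
        have : NeZero (μ.restrict (Metric.ball (π x) (R / 2))) :=
          ⟨fun h0 => hpos.ne' (Measure.restrict_eq_zero.1 h0)⟩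
        have h1 : ‖f x - L (π x) f‖ₑ ≤ ⨍⁻ y in Metric.ball (π x) (R / 2), ‖f y - f x‖ₑ ∂μ := by
          rw [hL, average, laverage_eq', enorm_sub_rev]
          have hi' := (hi.integrableOn (s := Metric.ball (π x) (R / 2))).to_average
          calc _ = ‖∫ y, (f y - f x) ∂((μ.restrict (Metric.ball (π x) (R / 2)) Set.univ)⁻¹ •
                  μ.restrict (Metric.ball (π x) (R / 2)))‖ₑ := by
                rw [integral_sub hi' (integrable_const _), integral_const, probReal_univ, one_smul]
            _ ≤ _ := enorm_integral_le_lintegral_enorm _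
        calc ‖f x - L (π x) f‖ₑ ^ q
            ≤ (⨍⁻ y in Metric.ball (π x) (R / 2), ‖f y - f x‖ₑ ∂μ) ^ q := by gcongr
          _ ≤ ⨍⁻ y in Metric.ball (π x) (R / 2), ‖f y - f x‖ₑ ^ q ∂μ :=
              laverage_rpow_le hq
                ((Lp.stronglyMeasurable f).measurable.sub_const _).enorm.aemeasurable
          _ ≤ _ := by
              refine setLAverage_le_mul_setLAverage
                (Metric.ball_subset_ball' (by linarith [hπ x])) hpos.ne' (measure_ne_top _ _)
                (hD x (π x) (R / 2) R (half_pos hR) ?_) _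
              rw [dist_comm]
              linarith [hπ x]
    _ = _ := by
        rw [lintegral_const_mul' _ _ ENNReal.coe_ne_top]
        congr 1
        exact (mul_energyFun q hR (by linarith) f).symm

end

/-! ### Sequential compactness for `Γ`-convergence. -/

section


theorem coe_liminf_ennreal (x : ℕ → ℝ≥0∞) :
    ((liminf x atTop : ℝ≥0∞) : EReal) = liminf (fun n => (x n : EReal)) atTop :=
  Monotone.map_liminf_of_continuousAt (fun _ _ h => EReal.coe_ennreal_le_coe_ennreal_iff.2 h) x
    continuous_coe_ennreal_ereal.continuousAt

theorem coe_limsup_ennreal (x : ℕ → ℝ≥0∞) :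
    ((limsup x atTop : ℝ≥0∞) : EReal) = limsup (fun n => (x n : EReal)) atTop :=
  Monotone.map_limsup_of_continuousAt (fun _ _ h => EReal.coe_ennreal_le_coe_ennreal_iff.2 h) x
    continuous_coe_ennreal_ereal.continuousAt

/-- Sequential compactness of `Γ`-convergence for nonnegative functionals. -/
theorem exists_gammaConverges_subseq {V : Type*} [NormedAddCommGroup V]
    [SecondCountableTopology V] (E : ℕ → V → ℝ≥0∞) :
    ∃ (φ : ℕ → ℕ) (F : V → EReal), StrictMono φ ∧
      GammaConverges (fun n f => (E (φ n) f : EReal)) F := by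
  obtain ⟨b, hbc, -, hb⟩ := TopologicalSpace.exists_countable_basis V
  have : Countable b := hbc.to_subtype
  -- The infima over a countable basis form a sequence in a countable power of `[0, ∞]`, which is
  -- sequentially compact.
  obtain ⟨a, φ, hφ, ha⟩ := CompactSpace.tendsto_subseq
    fun (n : ℕ) (U : b) => ⨅ v ∈ (U : Set V), E n v
  rw [tendsto_pi_nhds] at ha
  set F : V → ℝ≥0∞ := fun f => ⨆ (U : b) (_ : f ∈ (U : Set V)), a U with hF
  refine ⟨φ, fun f => F f, hφ, fun f u hu => ?_, fun f => ?_⟩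
  · rw [← coe_liminf_ennreal, EReal.coe_ennreal_le_coe_ennreal_iff]
    refine iSup₂_le fun U hU => ?_
    rw [← (ha U).liminf_eq]
    refine liminf_le_liminf ?_
    filter_upwards [hu ((hb.isOpen U.2).mem_nhds hU)] with n hn
    exact iInf₂_le (u n) hn
  · by_cases hFf : F f = ∞
    · refine ⟨fun _ => f, tendsto_const_nhds, ?_⟩
      simp only [hFf, EReal.coe_ennreal_top, le_top]
    -- `θ n` is the best simultaneous bound on distance to `f` and excess energy. Near-minimisers,
    -- up to the slack `1 / n`, form the recovery sequence.
    set θ : ℕ → ℝ≥0∞ := fun n => ⨅ v, max (edist v f) (E (φ n) v - F f) with hθ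
    have hθ0 : Tendsto θ atTop (𝓝 0) := by
      rw [ENNReal.tendsto_nhds_zero]
      intro ε hε
      obtain ⟨U, hUb, hfU, hU⟩ := hb.mem_nhds_iff.1 (Metric.eball_mem_nhds f hε)
      have hlt : a ⟨U, hUb⟩ < F f + ε :=
        (le_iSup₂ (f := fun (U : b) (_ : f ∈ (U : Set V)) => a U) ⟨U, hUb⟩ hfU).trans_lt
          (ENNReal.lt_add_right hFf hε.ne')
      filter_upwards [(ha ⟨U, hUb⟩).eventually_lt_const hlt] with n hn
      obtain ⟨v, hvE⟩ := iInf_lt_iff.1 hn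
      obtain ⟨hv, hvE⟩ := iInf_lt_iff.1 hvE
      refine (iInf_le _ v).trans (max_le (hU hv).le ?_)
      exact tsub_le_iff_left.2 hvE.le
    have hδ : Tendsto (fun n : ℕ => θ n + (n : ℝ≥0∞)⁻¹) atTop (𝓝 0) := by
      simpa using hθ0.add ENNReal.tendsto_inv_nat_nhds_zero
    have hex : ∀ n : ℕ, ∃ v, max (edist v f) (E (φ n) v - F f) ≤ θ n + (n : ℝ≥0∞)⁻¹ := by
      intro n
      by_cases ht : θ n = ∞
      · exact ⟨f, by simp [ht]⟩
      · obtain ⟨v, hv⟩ := iInf_lt_iff.1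
          (ENNReal.lt_add_right ht (ENNReal.inv_ne_zero.2 (ENNReal.natCast_ne_top n)))
        exact ⟨v, hv.le⟩
    choose v hv using hex
    refine ⟨v, ?_, ?_⟩
    · rw [tendsto_iff_edist_tendsto_0]
      exact tendsto_of_tendsto_of_tendsto_of_le_of_le tendsto_const_nhds hδ (fun _ => zero_le)
        fun n => (le_max_left _ _).trans (hv n)
    · rw [← coe_limsup_ennreal, EReal.coe_ennreal_le_coe_ennreal_iff]
      have hlim : Tendsto (fun n : ℕ => F f + (θ n + (n : ℝ≥0∞)⁻¹)) atTop (𝓝 (F f)) := by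
        simpa using hδ.const_add (F f)
      rw [← hlim.limsup_eq]
      refine limsup_le_limsup (Eventually.of_forall fun n => ?_)
      exact tsub_le_iff_left.1 ((le_max_right _ _).trans (hv n))

/-! ### Compactness, the domain of the limit and Mosco convergence. -/

variable {X : Type*} [PseudoMetricSpace X] [CompactSpace X] [MeasurableSpace X] [BorelSpace X]
  {μ : Measure X} {p : ℝ≥0∞} [hp1 : Fact (1 ≤ p)]

theorem PoincareLip.exists_energy_le_energy (hp : p ≠ ∞) (hd : IsDoubling μ)
    (h : PoincareLip p μ) :
    ∃ C : ℝ≥0, ∀ r R : ℝ, 0 < r → r ≤ R → ∀ f : Lp ℝ p μ,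
      energy p μ R f ≤ C * energy p μ r f := by
  have := hd.isFiniteMeasure
  have hq : 1 ≤ p.toReal := by simpa using ENNReal.toReal_mono hp hp1.out
  obtain ⟨C, hC⟩ := h.exists_energyFun_le_energyFun hq hd
  exact ⟨C, fun r R hr hrR f => hC r R hr hrR f (Lp.stronglyMeasurable f).measurable
    ((Lp.memLp f).integrable hp1.out)⟩

/-- The energy at a fixed scale is continuous in `L^p` up to constants. -/
theorem IsDoubling.exists_energy_le_add (hp : p ≠ ∞) (hd : IsDoubling μ) :
    ∃ C : ℝ≥0, ∀ R : ℝ, 0 < R → ∀ f g : Lp ℝ p μ,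
      energy p μ R f
        ≤ C * (energy p μ R g + (ENNReal.ofReal R ^ p.toReal)⁻¹ * ‖f - g‖ₑ ^ p.toReal) := by
  have := hd.isFiniteMeasure
  have hq : 1 ≤ p.toReal := by simpa using ENNReal.toReal_mono hp hp1.out
  have hc : (2 : ℝ≥0∞) ^ (p.toReal - 1) ≠ ∞ :=
    ENNReal.rpow_ne_top_of_nonneg (by linarith) (by simp)
  obtain ⟨C, hC⟩ := hd.exists_energyFun_le_lintegral hq
  refine ⟨((2 : ℝ≥0∞) ^ (p.toReal - 1)).toNNReal * (1 + C), fun R hR f g => ?_⟩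
  push_cast
  rw [ENNReal.coe_toNNReal hc]
  have hfm := (Lp.stronglyMeasurable f).measurable
  have hgm := (Lp.stronglyMeasurable g).measurable
  have hnorm : ∫⁻ x, ‖f x - g x‖ₑ ^ p.toReal ∂μ = ‖f - g‖ₑ ^ p.toReal := by
    rw [Lp_enorm_rpow (zero_lt_one.trans_le hp1.out).ne' hp]
    refine lintegral_congr_ae ((Lp.coeFn_sub f g).mono fun x hx => ?_)
    simp only [hx, Pi.sub_apply]
  calc energy p μ R f
      ≤ 2 ^ (p.toReal - 1) * (energyFun p.toReal μ R g
          + energyFun p.toReal μ R (fun x => f x - g x)) := energyFun_le_add hq R f hgm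
    _ ≤ 2 ^ (p.toReal - 1) * (energyFun p.toReal μ R g
          + C * (ENNReal.ofReal R ^ p.toReal)⁻¹ * ‖f - g‖ₑ ^ p.toReal) := by
        rw [← hnorm]
        gcongr
        exact hC R hR _ (hfm.sub hgm)
    _ ≤ 2 ^ (p.toReal - 1) * ((1 + C) * energyFun p.toReal μ R g
          + (1 + C) * ((ENNReal.ofReal R ^ p.toReal)⁻¹ * ‖f - g‖ₑ ^ p.toReal)) := by
        refine mul_le_mul' le_rfl (add_le_add ?_ ?_)
        · exact le_mul_of_one_le_left' le_self_add
        · rw [mul_assoc]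
          gcongr
          exact le_add_self
    _ = 2 ^ (p.toReal - 1) * (1 + C) * (energyFun p.toReal μ R g
          + (ENNReal.ofReal R ^ p.toReal)⁻¹ * ‖f - g‖ₑ ^ p.toReal) := by ring

/-- A Rellich-Kondrachov type theorem: a weakly convergent family whose energies at vanishing
scales stay bounded converges strongly. -/
theorem PoincareLip.tendsto_of_forall_dual_tendsto (hp : p ≠ ∞) (hd : IsDoubling μ)
    (h : PoincareLip p μ) {ι : Type*} {l : Filter ι} {r : ι → ℝ} (hr : ∀ n, 0 < r n)
    (hr0 : Tendsto r l (𝓝 0)) {u : ι → Lp ℝ p μ} {f : Lp ℝ p μ}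
    (hu : ∀ ψ : Lp ℝ p μ →L[ℝ] ℝ, Tendsto (fun n => ψ (u n)) l (𝓝 (ψ f)))
    {M : ℝ≥0∞} (hM : M ≠ ∞) (hE : ∀ᶠ n in l, energy p μ (r n) (u n) ≤ M) :
    Tendsto u l (𝓝 f) := by
  rcases l.eq_or_neBot with rfl | hl
  · exact tendsto_bot
  have := hd.isFiniteMeasure
  have hq : 1 ≤ p.toReal := by simpa using ENNReal.toReal_mono hp hp1.out
  have hq0 : 0 < p.toReal := by linarith
  obtain ⟨C, hC⟩ := h.exists_energy_le_energy hp hd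
  obtain ⟨C', hC'⟩ := hd.exists_finite_rank_approx hp
  rw [Metric.tendsto_nhds]
  intro ε hε
  have hε3 : 0 < ε / 3 := by positivity
  obtain ⟨R, hRε, hR⟩ : ∃ R : ℝ,
      C' * (ENNReal.ofReal R ^ p.toReal * (C * M)) < ENNReal.ofReal (ε / 3) ^ p.toReal ∧ 0 < R := by
    have hlim : Tendsto (fun R : ℝ => C' * (ENNReal.ofReal R ^ p.toReal * (C * M))) (𝓝[>] 0)
        (𝓝 0) := by
      have h1 : Tendsto (fun R : ℝ => ENNReal.ofReal R ^ p.toReal) (𝓝[>] 0) (𝓝 0) := by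
        have := ((ENNReal.continuous_rpow_const (y := p.toReal)).comp
          ENNReal.continuous_ofReal).tendsto (0 : ℝ)
        simp only [Function.comp_def, ENNReal.ofReal_zero, ENNReal.zero_rpow_of_pos hq0] at this
        exact this.mono_left nhdsWithin_le_nhds
      have h2 := ENNReal.Tendsto.mul_const (b := C * M) h1 (Or.inr (by finiteness))
      have h3 := ENNReal.Tendsto.const_mul (a := (C' : ℝ≥0∞)) h2 (Or.inr ENNReal.coe_ne_top)
      simpa using h3
    have hpos : 0 < ENNReal.ofReal (ε / 3) ^ p.toReal :=
      ENNReal.rpow_pos (ENNReal.ofReal_pos.2 hε3) ENNReal.ofReal_ne_top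
    exact ((hlim.eventually_lt_const hpos).and self_mem_nhdsWithin).exists
  obtain ⟨t, L, e, hP⟩ := hC' R hR
  set P : Lp ℝ p μ →L[ℝ] Lp ℝ p μ := ∑ c ∈ t, (L c).smulRight (e c) with hPdef
  have hPapp : ∀ g, P g = ∑ c ∈ t, L c g • e c := fun g => by simp [hPdef]
  have happrox : ∀ᶠ n in l, ‖u n - P (u n)‖ ≤ ε / 3 := by
    filter_upwards [hE, hr0.eventually_lt_const hR] with n hn hnR
    have h1 : ‖u n - P (u n)‖ₑ ^ p.toReal ≤ ENNReal.ofReal (ε / 3) ^ p.toReal := by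
      rw [hPapp]
      refine (hP (u n)).trans (le_trans ?_ hRε.le)
      gcongr
      exact (hC (r n) R (hr n) hnR.le (u n)).trans (by gcongr)
    rw [ENNReal.rpow_le_rpow_iff hq0, ← ofReal_norm] at h1
    exact (ENNReal.ofReal_le_ofReal_iff hε3.le).1 h1
  -- Weak lower semicontinuity of the norm, through a functional norming `f - P f`.
  have hf : ‖f - P f‖ ≤ ε / 3 := by
    obtain ⟨ψ, hψ, hψf⟩ := exists_dual_vector'' ℝ (f - P f)
    have hlim : Tendsto (fun n => ψ (u n - P (u n))) l (𝓝 ‖f - P f‖) := by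
      have := hu (ψ ∘L (ContinuousLinearMap.id ℝ _ - P))
      rw [ContinuousLinearMap.comp_apply, sub_apply] at this
      rw [ContinuousLinearMap.id_apply, hψf] at this
      exact this
    refine le_of_tendsto hlim (happrox.mono fun n hn => ?_)
    calc ψ (u n - P (u n)) ≤ ‖ψ (u n - P (u n))‖ := le_abs_self _
      _ ≤ 1 * ‖u n - P (u n)‖ := ψ.le_of_opNorm_le hψ _
      _ ≤ ε / 3 := by rwa [one_mul]
  -- Finite rank turns weak convergence into norm convergence.
  have hPu : Tendsto (fun n => P (u n)) l (𝓝 (P f)) := by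
    simp_rw [hPapp]
    exact tendsto_finsetSum _ fun c _ => (hu (L c)).smul_const (e c)
  filter_upwards [happrox, (Metric.tendsto_nhds.1 hPu) (ε / 3) hε3] with n h1 h2
  rw [dist_eq_norm] at h2 ⊢
  calc ‖u n - f‖ = ‖(u n - P (u n)) + (P (u n) - P f) - (f - P f)‖ := by congr 1; abel
    _ ≤ ‖u n - P (u n)‖ + ‖P (u n) - P f‖ + ‖f - P f‖ :=
        (norm_sub_le _ _).trans (add_le_add_left (norm_add_le _ _) _)
    _ < ε := by linarith

theorem IsPEnergy.setOf_lt_top_eq_space (hp : p ≠ ∞) (hd : IsDoubling μ) (h : PoincareLip p μ)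
    {r : ℕ → ℝ} {F : Lp ℝ p μ → EReal} (hF : IsPEnergy p μ r F) :
    {f | F f < ⊤} = space p μ := by
  have := hd.isFiniteMeasure
  have hq : 1 ≤ p.toReal := by simpa using ENNReal.toReal_mono hp hp1.out
  have hq0 : 0 < p.toReal := by linarith
  ext f
  simp only [Set.mem_ofPred_eq, space]
  constructor
  · intro hf
    obtain ⟨u, hu, hlim⟩ := hF.gammaConverges.2 f
    obtain ⟨c, hc1, hc2⟩ := exists_between (hlim.trans_lt hf)
    have hcE := eventually_lt_of_limsup_lt hc1
    obtain ⟨C, hC⟩ := h.exists_energy_le_energy hp hd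
    obtain ⟨C', hC'⟩ := hd.exists_energy_le_add (p := p) hp
    have hct : c.toENNReal ≠ ∞ := by simpa using hc2.ne
    -- For fixed `R`, take `n` with `r n < R` and `u n` so close to `f` that the error is below `1`;
    -- the bound is independent of `R`.
    have hbound : ∀ R : ℝ, 0 < R → energy p μ R f ≤ C' * (C * c.toENNReal + 1) := by
      intro R hR
      have e1 : (ENNReal.ofReal R ^ p.toReal)⁻¹ ≠ ∞ := by
        simp [ENNReal.rpow_eq_zero_iff, hR, hq0.not_gt]
      have hlim0 : Tendsto (fun n => (ENNReal.ofReal R ^ p.toReal)⁻¹ * ‖f - u n‖ₑ ^ p.toReal)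
          atTop (𝓝 0) := by
        have h1 : Tendsto (fun n => ‖f - u n‖ₑ ^ p.toReal) atTop (𝓝 0) := by
          have h2 : Tendsto (fun n => f - u n) atTop (𝓝 0) := by
            simpa using hu.const_sub f
          have h3 := ((ENNReal.continuous_rpow_const (y := p.toReal)).tendsto _).comp h2.enorm
          simpa [ENNReal.zero_rpow_of_pos hq0, Function.comp_def] using h3
        simpa using ENNReal.Tendsto.const_mul h1 (Or.inr e1)
      obtain ⟨n, hn1, hn2, hn3⟩ := (hcE.and ((hF.tendsto_zero.eventually_lt_const hR).and
        (hlim0.eventually_lt_const one_pos))).exists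
      refine (hC' R hR f (u n)).trans ?_
      gcongr
      refine (hC (r n) R (hF.pos n) hn2.le (u n)).trans ?_
      gcongr
      simpa using EReal.toENNReal_le_toENNReal hn1.le
    refine lt_of_le_of_lt (limsup_le_of_le (by isBoundedDefault) ?_)
      (show C' * (C * c.toENNReal + 1) < ∞ by finiteness)
    filter_upwards [self_mem_nhdsWithin] with R hR using hbound R hR
  · intro hf
    obtain ⟨c, hc1, hc2⟩ := exists_between hf
    have hev := eventually_lt_of_limsup_lt hc1
    have hr : Tendsto r atTop (𝓝[>] 0) :=
      tendsto_nhdsWithin_iff.2 ⟨hF.tendsto_zero, Eventually.of_forall hF.pos⟩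
    refine (hF.gammaConverges.1 f (fun _ => f) tendsto_const_nhds).trans_lt ?_
    refine lt_of_le_of_lt (b := (c : EReal)) ?_ ?_
    · refine liminf_le_of_frequently_le (Eventually.frequently ?_) (by isBoundedDefault)
      filter_upwards [hr.eventually hev] with n hn
      exact EReal.coe_ennreal_le_coe_ennreal_iff.2 hn.le
    · rw [← EReal.coe_ennreal_top, EReal.coe_ennreal_lt_coe_ennreal_iff]
      exact hc2

theorem IsPEnergy.moscoConverges (hp : p ≠ ∞) (hd : IsDoubling μ) (h : PoincareLip p μ)
    {r : ℕ → ℝ} {F : Lp ℝ p μ → EReal} (hF : IsPEnergy p μ r F) :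
    MoscoConverges (fun n f => (energy p μ (r n) f : EReal)) F := by
  classical
  refine ⟨fun f u hu => ?_, hF.gammaConverges.2⟩
  by_contra! hlt
  obtain ⟨c, hc1, hc2⟩ := exists_between hlt
  have hfreq : ∃ᶠ n in atTop, (energy p μ (r n) (u n) : EReal) < c :=
    frequently_lt_of_liminf_lt (by isBoundedDefault) hc1
  have hct : c.toENNReal ≠ ∞ := by simpa using (hc2.trans_le le_top).ne
  -- The energies are bounded along the infinite set `S`, so `u` converges strongly there.
  set S := {n | (energy p μ (r n) (u n) : EReal) < c} with hS
  have hweak : ∀ ψ : Lp ℝ p μ →L[ℝ] ℝ, Tendsto (fun n => ψ (u n)) atTop (𝓝 (ψ f)) := fun ψ =>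
    ((WeakBilin.eval_continuous (topDualPairing ℝ (Lp ℝ p μ)).flip ψ).tendsto _).comp hu
  have hstrong : Tendsto u (atTop ⊓ 𝓟 S) (𝓝 f) := by
    refine h.tendsto_of_forall_dual_tendsto hp hd hF.pos (hF.tendsto_zero.mono_left inf_le_left)
      (fun ψ => (hweak ψ).mono_left inf_le_left) hct ?_
    filter_upwards [mem_inf_of_right (mem_principal_self S)] with n hn
    simpa using EReal.toENNReal_le_toENNReal (le_of_lt hn)
  -- Filling in `f` off `S` gives a strongly convergent full sequence; its energies are still
  -- frequently below `c`, against the `Γ` lower bound.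
  have hv : Tendsto (fun n => if n ∈ S then u n else f) atTop (𝓝 f) :=
    hstrong.if tendsto_const_nhds
  have hle := hF.gammaConverges.1 f _ hv
  refine (hc2.trans_le hle).not_ge ?_
  refine liminf_le_of_frequently_le (hfreq.mono fun n hn => ?_) (by isBoundedDefault)
  have hnS : n ∈ S := hn
  simpa only [hnS, if_true] using hn.le

end

end KorevaarSchoen

theorem mainTheorem6 {X : Type*} [MetricSpace X] [CompactSpace X] [MeasurableSpace X]
    [BorelSpace X] (μ : Measure X) (p : ℝ≥0∞) [Fact (1 ≤ p)] (hp : p ≠ ∞)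
    (hdoubling : KorevaarSchoen.IsDoubling μ) (hpoincare : KorevaarSchoen.PoincareLip p μ) :
    (∃ (r : ℕ → ℝ) (F : Lp ℝ p μ → EReal), KorevaarSchoen.IsPEnergy p μ r F) ∧
    ∀ (r : ℕ → ℝ) (F : Lp ℝ p μ → EReal), KorevaarSchoen.IsPEnergy p μ r F →
      {f | F f < ⊤} = KorevaarSchoen.space p μ ∧
      KorevaarSchoen.MoscoConverges
        (fun n f => (KorevaarSchoen.energy p μ (r n) f : EReal)) F := by
  refine ⟨?_, fun r F hF => ⟨hF.setOf_lt_top_eq_space hp hdoubling hpoincare,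
    hF.moscoConverges hp hdoubling hpoincare⟩⟩
  have := hdoubling.isFiniteMeasure
  -- Makes second countability of `L^p` available to instance search.
  have : Fact (p ≠ ∞) := ⟨hp⟩
  obtain ⟨φ, F, hφ, hF⟩ := KorevaarSchoen.exists_gammaConverges_subseq
    fun (n : ℕ) (f : Lp ℝ p μ) => KorevaarSchoen.energy p μ (1 / ((n : ℝ) + 1)) f
  exact ⟨fun n => 1 / ((φ n : ℝ) + 1), F, fun n => by positivity,
    tendsto_one_div_add_atTop_nhds_zero_nat.comp hφ.tendsto_atTop, hF⟩
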